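/- Let $\bar G$ be the row-normalized adjacency matrix of a finite simple undirected graph $G$ with $n$ vertices (rows of isolated vertices are left null). For $\alpha\in[0,1)$, the PageRank of $G$ with damping factor $\alpha$ and uniform preference vector is the row vector $(1-\alpha)\,\tfrac1n\mathbf 1\,(1-\alpha\bar G)^{-1}$, divided by its $\ell_1$-norm (which is $1$ if $G$ has no isolated vertices). A centrality $c$ is \emph{rank monotone on} $G$ if for every pair of distinct non-adjacent vertices $x,y$ of $G$ and every vertex $z\ne x,y$ one has $$c_G(x)\ge c_G(z)\Rightarrow c_{G'}(x)\ge c_{G'}(z)\quad\text{and}\quad c_G(y)\ge c_G(z)\Rightarrow c_{G'}(y)\ge c_{G'}(z),$$ where $G'$ is $G$ with the edge $xy$ added. For $k\ge 3$ let $G_k$ be the following graph on $2k+4$ vertices: a $k$-clique with one vertex named $1$; a disjoint $k$-clique with two of its vertices named $6$ and $7$; four more vertices $2,3,4,5$; and, besides the edges of the two cliques, exactly the edges $12$, $23$, $36$, $14$, $45$. **Theorem.** For every damping factor $\alpha\in(0,1)$ there is a finite simple undirected graph on which PageRank (with uniform preference vector) is not rank monotone. More precisely, for every $\alpha\in(0,1)$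 there is a $K$ such that for all $k\ge K$ the vertices $5$ and $7$ of $G_k$ are not adjacent, the PageRank of vertex $5$ in $G_k$ is strictly greater than that of vertex $2$, and after the edge between $5$ and $7$ is added the PageRank of vertex $5$ is strictly smaller than that of vertex $2$. -/

import Mathlib

namespace SpectralRank

open Matrix

/-- The graph obtained from `G` by adding the new edge `x — y`. -/
def addEdge {V : Type*} (G : SimpleGraph V) (x y : V) : SimpleGraph V :=
  G ⊔ SimpleGraph.edge x y

/-- A centrality `c` is rank monotone on the undirected graph `G`: for every pair of non-adjacent
vertices `x`, `y`, after adding the edge `x — y` every other vertex `z` that had a score smaller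
than or equal to that of `x` (of `y`) still has a score smaller than or equal to it. -/
def IsRankMonotoneOn {V : Type*} (c : SimpleGraph V → V → ℝ) (G : SimpleGraph V) : Prop :=
  ∀ x y : V, x ≠ y → ¬ G.Adj x y → ∀ z : V, z ≠ x → z ≠ y →
    (c G z ≤ c G x → c (addEdge G x y) z ≤ c (addEdge G x y) x) ∧
    (c G z ≤ c G y → c (addEdge G x y) z ≤ c (addEdge G x y) y)

section PageRank

variable {V : Type*} [Fintype V]

open Classical in
/-- The row-normalized adjacency matrix of `G`; null rows are left untouched. -/
noncomputable def normAdj (G : SimpleGraph V) : Matrix V V ℝ :=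
  Matrix.of fun i j => if G.Adj i j then 1 / (G.degree i : ℝ) else 0

open Classical in
/-- The row vector `(1 - α) v (1 - α Ḡ)⁻¹`, where `Ḡ` is the row-normalized adjacency matrix
and `v` is the preference vector. -/
noncomputable def dampedRank (α : ℝ) (v : V → ℝ) (G : SimpleGraph V) : V → ℝ :=
  (1 - α) • (v ᵥ* (1 - α • normAdj G)⁻¹)

/-- PageRank with damping factor `α` and uniform preference vector. The final `ℓ₁`-normalization
has an effect only if `G` has isolated vertices. -/
noncomputable def pageRank (α : ℝ) (G : SimpleGraph V) (x : V) : ℝ :=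
  dampedRank α (fun _ => 1 / (Fintype.card V : ℝ)) G x /
    ∑ z, dampedRank α (fun _ => 1 / (Fintype.card V : ℝ)) G z

open Classical in
/-- The inverse used in `dampedRank` is a true inverse for every damping factor in `[0, 1)`. -/
theorem isUnit_det_one_sub (α : ℝ) (h0 : 0 ≤ α) (h1 : α < 1) (G : SimpleGraph V) :
    IsUnit (1 - α • normAdj G).det := by
  have hrow : ∀ i, ∑ j, normAdj G i j ≤ 1 := by
    intro i
    have : ∑ j, normAdj G i j = (G.degree i : ℝ) * (1 / (G.degree i : ℝ)) := by
      simp only [normAdj, Matrix.of_apply]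
      rw [← Finset.sum_filter, Finset.sum_const, nsmul_eq_mul]
      congr 2
      rw [← SimpleGraph.card_neighborFinset_eq_degree, SimpleGraph.neighborFinset_eq_filter]
    rw [this, mul_one_div]
    exact div_self_le_one _
  have hnn : ∀ i j, 0 ≤ normAdj G i j := by
    intro i j
    simp only [normAdj, Matrix.of_apply]
    split_ifs <;> positivity
  refine isUnit_iff_ne_zero.mpr (det_ne_zero_of_sum_row_lt_diag fun i => ?_)
  have hd : normAdj G i i = 0 := by simp [normAdj]
  have e : ∑ j ∈ Finset.univ.erase i, ‖(1 - α • normAdj G) i j‖ = α * ∑ j, normAdj G i j := by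
    rw [← Finset.add_sum_erase _ _ (Finset.mem_univ i), hd, zero_add, Finset.mul_sum]
    refine Finset.sum_congr rfl fun j hj => ?_
    rw [Matrix.sub_apply, Matrix.one_apply_ne (Finset.ne_of_mem_erase hj).symm, zero_sub, norm_neg,
      Matrix.smul_apply, smul_eq_mul, Real.norm_of_nonneg (mul_nonneg h0 (hnn i j))]
  rw [e, Matrix.sub_apply, Matrix.one_apply_eq, Matrix.smul_apply, hd, smul_zero, sub_zero, norm_one]
  calc α * ∑ j, normAdj G i j ≤ α * 1 := mul_le_mul_of_nonneg_left (hrow i) h0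
    _ < 1 := by linarith

end PageRank

section Witness

/-- The number of vertices of `G_k` that carry a given label. The first `k`-clique consists of the
vertices labelled `0` and `1`, the second one of those labelled `6`, `7` and `8`; the other four
vertices are `2`, `3`, `4` and `5`. -/
def labelCount (k : ℕ) : Fin 9 → ℕ := ![k - 1, 1, 1, 1, 1, 1, 1, 1, k - 2]

/-- The vertices of `G_k`: a label and an index among the vertices with that label. -/
abbrev Vertex (k : ℕ) : Type := (l : Fin 9) × Fin (labelCount k l)

/-- The pairs of labels of adjacent vertices of `G_k`: the two cliques on the first and last line,
and the edges `1 — 2`, `2 — 3`, `3 — 6`, `1 — 4`, `4 — 5` of the gadget. -/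
def linkedLabels : Finset (Fin 9 × Fin 9) :=
  {(0, 0), (0, 1),
   (1, 2), (2, 3), (3, 6), (1, 4), (4, 5),
   (6, 7), (6, 8), (7, 8), (8, 8)}

/-- The graph `G_k`: two distinct vertices are adjacent when their labels are linked. -/
def graphG (k : ℕ) : SimpleGraph (Vertex k) :=
  SimpleGraph.fromRel fun x y => (x.1, y.1) ∈ linkedLabels

/-- The only vertex of `G_k` with label `2`. -/
def node2 (k : ℕ) : Vertex k := ⟨2, ⟨0, Nat.one_pos⟩⟩

/-- The only vertex of `G_k` with label `5`. -/
def node5 (k : ℕ) : Vertex k := ⟨5, ⟨0, Nat.one_pos⟩⟩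

/-- The only vertex of `G_k` with label `7`. -/
def node7 (k : ℕ) : Vertex k := ⟨7, ⟨0, Nat.one_pos⟩⟩

end Witness

end SpectralRank

namespace SpectralRank

open Filter Topology Matrix

/-! ### PageRank divided by degree, as a potential on the graph. -/

section Potential

variable {V : Type*} [Fintype V]

/-! Without isolated vertices, PageRank is proportional to `deg * g`, where the potential `g` lies
in `(0, 1 / (1 - α)]`. Summing `g` over the vertices with a given label reduces the problem to nine
numbers `S l`, because neighbourhoods depend only on labels, up to the vertex itself.

As the cliques grow, each attaching vertex (`1`, `6`, and `7` once joined to `5`) has potential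
`O(1/k)`, so it acts on the gadget as a zero boundary value. Before the addition, `2` lies on the
path `2 — 3` anchored at both ends, while `5` ends the path `4 — 5` anchored only at `4`. The limits
of `deg * g` are `2 / (2 - α)` and `(2 + α) / (2 - α ^ 2)`, and the latter is larger
(`eventually_pageRank_node2_lt_node5`).

Adding `5 — 7` anchors the second path at both ends too, and `2` and `5` tie in the limit. The `1/k`
term breaks the tie: vertex `1` has two gadget neighbours, `6` and `7` only one each, so `1` has the
larger potential, which favours `2` (`eventually_pageRank_addEdge_node5_lt_node2`). -/

open Classical in
/-- Without isolated vertices, PageRank is a positive multiple of `deg x * g x`, where `g` is the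
solution of `deg x * g x = 1 + α * ∑ y ~ x, g y`. -/
theorem exists_pageRank_potential [Nonempty V] (α : ℝ) (h0 : 0 < α) (h1 : α < 1)
    (G : SimpleGraph V) (hdeg : ∀ x, 0 < G.degree x) :
    ∃ (c : ℝ) (g : V → ℝ), 0 < c ∧
      (∀ x, (G.degree x : ℝ) * g x = 1 + α * ∑ y, if G.Adj x y then g y else 0) ∧
      (∀ x, 0 < g x) ∧ (∀ x, g x ≤ 1 / (1 - α)) ∧
      ∀ x, pageRank α G x = c * (G.degree x * g x) := by
  have hα : 0 < 1 - α := by linarith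
  have hd : ∀ x, (0 : ℝ) < G.degree x := fun x => by exact_mod_cast hdeg x
  have hn : (0 : ℝ) < Fintype.card V := by exact_mod_cast Fintype.card_pos
  obtain ⟨v, hv⟩ : ∃ v : V → ℝ, v = fun _ => 1 / (Fintype.card V : ℝ) := ⟨_, rfl⟩
  obtain ⟨r, hr⟩ : ∃ r : V → ℝ, r = dampedRank α v G := ⟨_, rfl⟩
  have hfix : r ᵥ* (1 - α • normAdj G) = (1 - α) • v := by
    rw [hr, dampedRank, Matrix.smul_vecMul, Matrix.vecMul_vecMul,
      Matrix.nonsing_inv_mul _ (isUnit_det_one_sub α h0.le h1 G), Matrix.vecMul_one]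
  have hr' : ∀ x, r x = (1 - α) / Fintype.card V +
      α * ∑ y, if G.Adj x y then r y / G.degree y else 0 := by
    intro x
    have h := congrFun hfix x
    rw [Matrix.vecMul_sub, Matrix.vecMul_one, Matrix.vecMul_smul] at h
    simp only [Pi.sub_apply, Pi.smul_apply, smul_eq_mul, hv, Matrix.vecMul, dotProduct] at h
    have e : ∑ y, r y * normAdj G y x = ∑ y, if G.Adj x y then r y / G.degree y else 0 := by
      refine Finset.sum_congr rfl fun y _ => ?_
      simp only [normAdj, Matrix.of_apply, G.adj_comm y x]
      split_ifs
      · rw [mul_one_div]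
      · rw [mul_zero]
    rw [e] at h
    rw [div_eq_mul_one_div]
    linarith
  obtain ⟨g, hg⟩ : ∃ g : V → ℝ, g = fun x => Fintype.card V / (1 - α) * (r x / G.degree x) :=
    ⟨_, rfl⟩
  have hrg : ∀ x, r x = (1 - α) / Fintype.card V * (G.degree x * g x) := by
    intro x
    have := (hd x).ne'
    rw [hg]
    field_simp
  have hgeq : ∀ x, (G.degree x : ℝ) * g x = 1 + α * ∑ y, if G.Adj x y then g y else 0 := by
    intro x
    have e : ∑ y, (if G.Adj x y then g y else 0) =
        Fintype.card V / (1 - α) * ∑ y, if G.Adj x y then r y / G.degree y else 0 := by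
      rw [Finset.mul_sum]
      refine Finset.sum_congr rfl fun y _ => ?_
      split_ifs
      · rw [hg]
      · rw [mul_zero]
    have h := hr' x
    rw [e]
    have h2 : (G.degree x : ℝ) * g x = Fintype.card V / (1 - α) * r x := by
      rw [hrg x]; field_simp
    rw [h2, h]
    field_simp
  have hcard : ∀ x (b : ℝ), ∑ y, (if G.Adj x y then b else 0) = G.degree x * b := by
    intro x b
    rw [← Finset.sum_filter, Finset.sum_const, nsmul_eq_mul,
      ← SimpleGraph.card_neighborFinset_eq_degree, SimpleGraph.neighborFinset_eq_filter]
  -- Minimum principle: at a minimiser, `(1 - α) * deg * g ≥ 1`.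
  have hpos : ∀ x, 0 < g x := by
    obtain ⟨x₀, hx₀⟩ := Finite.exists_min g
    have h : (G.degree x₀ : ℝ) * g x₀ ≥ 1 + α * (G.degree x₀ * g x₀) := by
      nth_rewrite 1 [hgeq x₀]
      rw [← hcard x₀ (g x₀)]
      gcongr with y _
      split_ifs
      · exact hx₀ y
      · exact le_rfl
    have h2 : 0 < (G.degree x₀ : ℝ) * g x₀ := by
      by_contra! hc
      nlinarith
    intro x
    exact (pos_of_mul_pos_right h2 (hd x₀).le).trans_le (hx₀ x)
  -- Dually, at a maximiser `(1 - α) * deg * g ≤ 1`, and `deg ≥ 1`.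
  have hle : ∀ x, g x ≤ 1 / (1 - α) := by
    obtain ⟨x₀, hx₀⟩ := Finite.exists_max g
    have h : (G.degree x₀ : ℝ) * g x₀ ≤ 1 + α * (G.degree x₀ * g x₀) := by
      nth_rewrite 1 [hgeq x₀]
      rw [← hcard x₀ (g x₀)]
      gcongr with y _
      split_ifs
      · exact hx₀ y
      · exact le_rfl
    have hd1 : (1 : ℝ) ≤ G.degree x₀ := by exact_mod_cast hdeg x₀
    intro x
    refine (hx₀ x).trans ?_
    rw [le_div_iff₀ hα]
    have := hpos x₀
    have h3 : 0 ≤ ((G.degree x₀ : ℝ) - 1) * (g x₀ * (1 - α)) :=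
      mul_nonneg (by linarith) (by positivity)
    nlinarith
  have hrpos : ∀ x, 0 < r x := fun x => by
    rw [hrg]
    have := hpos x
    have := hd x
    positivity
  have hsum : 0 < ∑ x, r x := Finset.sum_pos (fun x _ => hrpos x) Finset.univ_nonempty
  refine ⟨(1 - α) / Fintype.card V / ∑ x, r x, g, by positivity, hgeq, hpos, hle, fun x => ?_⟩
  rw [pageRank, ← hv, ← hr, hrg x]
  ring

end Potential

/-! ### Reduction to equations indexed by labels. -/

section LabelGraph

/-- The graph on labelled vertices in which distinct vertices with linked labels are adjacent. -/
def labelGraph (k : ℕ) (L : Finset (Fin 9 × Fin 9)) : SimpleGraph (Vertex k) :=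
  SimpleGraph.fromRel fun x y => (x.1, y.1) ∈ L

/-- The symmetric closure of the linking relation on labels. -/
abbrev Linked (L : Finset (Fin 9 × Fin 9)) (l m : Fin 9) : Prop := (l, m) ∈ L ∨ (m, l) ∈ L

/-- The degree of a vertex with label `l` in a label graph. -/
def labelDegree (k : ℕ) (L : Finset (Fin 9 × Fin 9)) (l : Fin 9) : ℝ :=
  (∑ m, if Linked L l m then (labelCount k m : ℝ) else 0) - if Linked L l l then 1 else 0

-- A self-linked label would count `x` among its own neighbours; the subtracted term corrects this.
open Classical in
theorem sum_adj_labelGraph (k : ℕ) (L : Finset (Fin 9 × Fin 9)) (x : Vertex k)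
    (g : Vertex k → ℝ) :
    ∑ y, (if (labelGraph k L).Adj x y then g y else 0) =
      (∑ m, if Linked L x.1 m then ∑ i, g ⟨m, i⟩ else 0) - if Linked L x.1 x.1 then g x else 0 := by
  have h : ∀ y, (if (labelGraph k L).Adj x y then g y else 0) =
      (if Linked L x.1 y.1 then g y else 0) -
        if y = x then (if Linked L x.1 x.1 then g x else 0) else 0 := by
    intro y
    simp only [labelGraph, SimpleGraph.fromRel_adj]
    by_cases hxy : y = x
    · subst hxy
      simp
    · simp [hxy, Ne.symm hxy]
  rw [Finset.sum_congr rfl fun y _ => h y, Finset.sum_sub_distrib, Finset.sum_ite_eq' Finset.univ x,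
    if_pos (Finset.mem_univ x), Fintype.sum_sigma]
  congr 1
  refine Finset.sum_congr rfl fun m _ => ?_
  split_ifs <;> simp

open Classical in
theorem degree_labelGraph (k : ℕ) (L : Finset (Fin 9 × Fin 9)) (x : Vertex k) :
    ((labelGraph k L).degree x : ℝ) = labelDegree k L x.1 := by
  have h := sum_adj_labelGraph k L x fun _ => 1
  rw [← Finset.sum_filter, Finset.sum_const, nsmul_eq_mul, mul_one] at h
  rw [← SimpleGraph.card_neighborFinset_eq_degree, SimpleGraph.neighborFinset_eq_filter, h,
    labelDegree]
  simp

/-- The potential of `exists_pageRank_potential`, summed over the vertices with a given label. -/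
theorem exists_pageRank_labelPotential (α : ℝ) (h0 : 0 < α) (h1 : α < 1) (k : ℕ)
    (L : Finset (Fin 9 × Fin 9)) (hL : ∀ l, 0 < labelDegree k L l) :
    ∃ (c : ℝ) (S : Fin 9 → ℝ), 0 < c ∧
      (∀ l, labelDegree k L l * S l = labelCount k l +
        α * (labelCount k l * (∑ m, if Linked L l m then S m else 0) -
          if Linked L l l then S l else 0)) ∧
      (∀ l, 0 ≤ S l) ∧ (∀ l, S l ≤ labelCount k l * (1 / (1 - α))) ∧
      pageRank α (labelGraph k L) (node2 k) = c * (labelDegree k L 2 * S 2) ∧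
      pageRank α (labelGraph k L) (node5 k) = c * (labelDegree k L 5 * S 5) := by
  classical
  have : Nonempty (Vertex k) := ⟨node2 k⟩
  have hdeg : ∀ x, 0 < (labelGraph k L).degree x := by
    intro x
    have := hL x.1
    rw [← degree_labelGraph] at this
    exact_mod_cast this
  obtain ⟨c, g, hc, hg, hpos, hle, hpr⟩ :=
    exists_pageRank_potential α h0 h1 (labelGraph k L) hdeg
  refine ⟨c, fun l => ∑ i, g ⟨l, i⟩, hc, fun l => ?_, fun l => ?_, fun l => ?_, ?_, ?_⟩
  · have h : ∀ i : Fin (labelCount k l), labelDegree k L l * g ⟨l, i⟩ =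
        1 + α * ((∑ m, if Linked L l m then ∑ i, g ⟨m, i⟩ else 0) -
          if Linked L l l then g ⟨l, i⟩ else 0) := by
      intro i
      have e := hg ⟨l, i⟩
      rw [degree_labelGraph, sum_adj_labelGraph] at e
      exact e
    rw [Finset.mul_sum, Finset.sum_congr rfl fun i _ => h i, Finset.sum_add_distrib,
      ← Finset.mul_sum, Finset.sum_sub_distrib, Finset.sum_const, Finset.sum_const]
    simp only [Finset.card_univ, Fintype.card_fin, nsmul_eq_mul, mul_one]
    congr 3
    split_ifs <;> simp
  · exact Finset.sum_nonneg fun i _ => (hpos _).le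
  · refine (Finset.sum_le_sum fun i _ => hle _).trans ?_
    simp
  · rw [hpr, degree_labelGraph]
    congr 2
    exact (Fin.sum_univ_one fun i : Fin 1 => g ⟨2, i⟩).symm
  · rw [hpr, degree_labelGraph]
    congr 2
    exact (Fin.sum_univ_one fun i : Fin 1 => g ⟨5, i⟩).symm

/-- The linked labels of `G_k` after the addition of the edge `5 — 7`. -/
def linkedLabelsAdd : Finset (Fin 9 × Fin 9) := insert (5, 7) linkedLabels

theorem addEdge_graphG (k : ℕ) :
    addEdge (graphG k) (node5 k) (node7 k) = labelGraph k linkedLabelsAdd := by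
  have h5 : ∀ x : Vertex k, x.1 = 5 ↔ x = node5 k := by
    rintro ⟨l, i⟩
    constructor
    · rintro rfl
      exact congrArg (Sigma.mk 5) (Subsingleton.elim (α := Fin 1) _ _)
    · rintro h
      rw [h]; rfl
  have h7 : ∀ x : Vertex k, x.1 = 7 ↔ x = node7 k := by
    rintro ⟨l, i⟩
    constructor
    · rintro rfl
      exact congrArg (Sigma.mk 7) (Subsingleton.elim (α := Fin 1) _ _)
    · rintro h
      rw [h]; rfl
  ext x y
  simp only [addEdge, graphG, labelGraph, linkedLabelsAdd, SimpleGraph.sup_adj,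
    SimpleGraph.edge_adj, SimpleGraph.fromRel_adj, Finset.mem_insert, Prod.mk.injEq, h5, h7]
  tauto

/-- Writing `k = m + 3` removes the truncated subtractions. -/
theorem labelCount_add_three (m : ℕ) (l : Fin 9) :
    (labelCount (m + 3) l : ℝ) = ![(m : ℝ) + 2, 1, 1, 1, 1, 1, 1, 1, m + 1] l := by
  fin_cases l <;> simp [labelCount]

theorem linked_self_linkedLabels (l : Fin 9) : Linked linkedLabels l l ↔ l = 0 ∨ l = 8 := by
  revert l
  decide

theorem linked_self_linkedLabelsAdd (l : Fin 9) :
    Linked linkedLabelsAdd l l ↔ l = 0 ∨ l = 8 := by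
  revert l
  decide

theorem sum_linked_linkedLabels (f : Fin 9 → ℝ) (l : Fin 9) :
    (∑ m, if Linked linkedLabels l m then f m else 0) =
      ![f 0 + f 1, f 0 + f 2 + f 4, f 1 + f 3, f 2 + f 6, f 1 + f 5, f 4, f 3 + f 7 + f 8,
        f 6 + f 8, f 6 + f 7 + f 8] l := by
  have h : ∀ l, Finset.univ.filter (Linked linkedLabels l) =
      ![{0, 1}, {0, 2, 4}, {1, 3}, {2, 6}, {1, 5}, {4}, {3, 7, 8}, {6, 8}, {6, 7, 8}] l := by
    decide
  rw [← Finset.sum_filter, h]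
  fin_cases l <;> simp [add_assoc]

theorem sum_linked_linkedLabelsAdd (f : Fin 9 → ℝ) (l : Fin 9) :
    (∑ m, if Linked linkedLabelsAdd l m then f m else 0) =
      ![f 0 + f 1, f 0 + f 2 + f 4, f 1 + f 3, f 2 + f 6, f 1 + f 5, f 4 + f 7, f 3 + f 7 + f 8,
        f 5 + f 6 + f 8, f 6 + f 7 + f 8] l := by
  have h : ∀ l, Finset.univ.filter (Linked linkedLabelsAdd l) =
      ![{0, 1}, {0, 2, 4}, {1, 3}, {2, 6}, {1, 5}, {4, 7}, {3, 7, 8}, {5, 6, 8}, {6, 7, 8}] l := by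
    decide
  rw [← Finset.sum_filter, h]
  fin_cases l <;> simp [add_assoc]

theorem labelDegree_graphG (m : ℕ) (l : Fin 9) :
    labelDegree (m + 3) linkedLabels l =
      ![(m : ℝ) + 2, m + 4, 2, 2, 2, 1, m + 3, m + 2, m + 2] l := by
  rw [labelDegree, sum_linked_linkedLabels]
  simp only [linked_self_linkedLabels, labelCount_add_three]
  fin_cases l <;> simp <;> ring

theorem labelDegree_addEdge (m : ℕ) (l : Fin 9) :
    labelDegree (m + 3) linkedLabelsAdd l =
      ![(m : ℝ) + 2, m + 4, 2, 2, 2, 2, m + 3, m + 3, m + 2] l := by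
  rw [labelDegree, sum_linked_linkedLabelsAdd]
  simp only [linked_self_linkedLabelsAdd, labelCount_add_three]
  fin_cases l <;> simp <;> ring

/-- The equations for the label sums of the potential on `G_{m+3}`. -/
theorem exists_potential_graphG (α : ℝ) (h0 : 0 < α) (h1 : α < 1) (m : ℕ) :
    ∃ (c : ℝ) (S : Fin 9 → ℝ), 0 < c ∧ (∀ l, 0 ≤ S l) ∧
      (∀ l, l ≠ 0 → l ≠ 8 → S l ≤ 1 / (1 - α)) ∧
      (m + 2) * S 0 = (m + 2) + α * ((m + 2) * (S 0 + S 1) - S 0) ∧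
      (m + 4) * S 1 = 1 + α * (S 0 + S 2 + S 4) ∧
      2 * S 2 = 1 + α * (S 1 + S 3) ∧
      2 * S 3 = 1 + α * (S 2 + S 6) ∧
      2 * S 4 = 1 + α * (S 1 + S 5) ∧
      S 5 = 1 + α * S 4 ∧
      (m + 3) * S 6 = 1 + α * (S 3 + S 7 + S 8) ∧
      (m + 2) * S 8 = (m + 1) + α * ((m + 1) * (S 6 + S 7 + S 8) - S 8) ∧
      pageRank α (graphG (m + 3)) (node2 (m + 3)) = c * (2 * S 2) ∧
      pageRank α (graphG (m + 3)) (node5 (m + 3)) = c * S 5 := by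
  obtain ⟨c, S, hc, he, hS, hle, h2, h5⟩ := exists_pageRank_labelPotential α h0 h1 (m + 3)
    linkedLabels (fun l => by
      rw [labelDegree_graphG]
      fin_cases l <;> simp <;> positivity)
  simp only [labelDegree_graphG, sum_linked_linkedLabels, linked_self_linkedLabels,
    labelCount_add_three] at he hle h2 h5
  refine ⟨c, S, hc, hS, fun l h h' => ?_, ?_, ?_, ?_, ?_, ?_, ?_, ?_, ?_, ?_, ?_⟩
  · have := hle l
    fin_cases l <;> simp_all
  · simpa using he 0
  · simpa using he 1
  · simpa using he 2
  · simpa using he 3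
  · simpa using he 4
  · simpa using he 5
  · simpa using he 6
  · simpa using he 8
  · exact h2
  · simpa [graphG, labelGraph] using h5

/-- The equations for the label sums of the potential on `G_{m+3}` with the edge `5 — 7` added. -/
theorem exists_potential_addEdge (α : ℝ) (h0 : 0 < α) (h1 : α < 1) (m : ℕ) :
    ∃ (c : ℝ) (S : Fin 9 → ℝ), 0 < c ∧ (∀ l, 0 ≤ S l) ∧
      (∀ l, l ≠ 0 → l ≠ 8 → S l ≤ 1 / (1 - α)) ∧
      (m + 2) * S 0 = (m + 2) + α * ((m + 2) * (S 0 + S 1) - S 0) ∧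
      (m + 4) * S 1 = 1 + α * (S 0 + S 2 + S 4) ∧
      2 * S 2 = 1 + α * (S 1 + S 3) ∧
      2 * S 3 = 1 + α * (S 2 + S 6) ∧
      2 * S 4 = 1 + α * (S 1 + S 5) ∧
      2 * S 5 = 1 + α * (S 4 + S 7) ∧
      (m + 3) * S 6 = 1 + α * (S 3 + S 7 + S 8) ∧
      (m + 3) * S 7 = 1 + α * (S 5 + S 6 + S 8) ∧
      (m + 2) * S 8 = (m + 1) + α * ((m + 1) * (S 6 + S 7 + S 8) - S 8) ∧
      pageRank α (addEdge (graphG (m + 3)) (node5 (m + 3)) (node7 (m + 3))) (node2 (m + 3)) =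
        c * (2 * S 2) ∧
      pageRank α (addEdge (graphG (m + 3)) (node5 (m + 3)) (node7 (m + 3))) (node5 (m + 3)) =
        c * (2 * S 5) := by
  rw [addEdge_graphG]
  obtain ⟨c, S, hc, he, hS, hle, h2, h5⟩ := exists_pageRank_labelPotential α h0 h1 (m + 3)
    linkedLabelsAdd (fun l => by
      rw [labelDegree_addEdge]
      fin_cases l <;> simp <;> positivity)
  simp only [labelDegree_addEdge, sum_linked_linkedLabelsAdd, linked_self_linkedLabelsAdd,
    labelCount_add_three] at he hle h2 h5
  refine ⟨c, S, hc, hS, fun l h h' => ?_, ?_, ?_, ?_, ?_, ?_, ?_, ?_, ?_, ?_, ?_, ?_⟩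
  · have := hle l
    fin_cases l <;> simp_all
  · simpa using he 0
  · simpa using he 1
  · simpa using he 2
  · simpa using he 3
  · simpa using he 4
  · simpa using he 5
  · simpa using he 6
  · simpa using he 7
  · simpa using he 8
  · simpa using h2
  · simpa using h5

end LabelGraph

/-! ### Limits of the label sums for large cliques. -/

section Asymptotics

theorem tendsto_zero_of_natCast_add_mul_bounded {u : ℕ → ℝ} {j C : ℝ} (hj : 0 < j)
    (h : ∀ m : ℕ, |(m + j) * u m| ≤ C) : Tendsto u atTop (𝓝 0) := by
  refine squeeze_zero_norm (fun m => ?_) (Tendsto.const_div_atTop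
    (tendsto_atTop_add_const_right atTop j tendsto_natCast_atTop_atTop) C)
  have hm : 0 < (m : ℝ) + j := by positivity
  rw [le_div_iff₀ hm, Real.norm_eq_abs, mul_comm, ← abs_of_pos hm, ← abs_mul]
  exact h m

/-- The potential of a clique, summed over all but a bounded number of its vertices, is bounded. -/
theorem clique_le {α a : ℝ} (h0 : 0 < α) (h1 : α < 1) (ha2 : a ≤ 2) {m : ℕ}
    {u v C : ℝ} (hu : 0 ≤ u) (hv : 0 ≤ v) (hvC : v ≤ C)
    (h : (m + 2) * u = (m + a) + α * ((m + a) * (u + v) - u)) : u ≤ (1 + C) / (1 - α) := by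
  rw [le_div_iff₀ (by linarith)]
  have hm : 0 < (m : ℝ) + 2 := by positivity
  refine le_of_mul_le_mul_left ?_ hm
  have h2 : ((m : ℝ) + a) * (1 + α * (u + v)) ≤ (m + 2) * (1 + α * (u + v)) := by gcongr
  have h3 : α * v ≤ C := by nlinarith
  have h4 : ((m : ℝ) + 2) * (α * v) ≤ (m + 2) * C := by gcongr
  nlinarith [mul_nonneg h0.le hu]

/-- Here `u` is the sum over the `m + a` ordinary clique vertices and `v` that over the attaching
ones. Dividing by `m + 2` leaves `u = 1 + α * (u + v)` up to `O(1/m)`, and `v` vanishes. -/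
theorem tendsto_clique {α a : ℝ} (h0 : 0 < α) (h1 : α < 1) (ha0 : 0 ≤ a) (ha2 : a ≤ 2)
    {u v : ℕ → ℝ} {C : ℝ} (hu : ∀ m, 0 ≤ u m) (hv : ∀ m, 0 ≤ v m) (hvC : ∀ m, v m ≤ C)
    (h : ∀ m : ℕ, (m + 2) * u m = (m + a) + α * ((m + a) * (u m + v m) - u m))
    (hv0 : Tendsto v atTop (𝓝 0)) : Tendsto u atTop (𝓝 (1 / (1 - α))) := by
  have hα : 1 - α ≠ 0 := by linarith
  have he : Tendsto (fun m => u m - 1 - α * (u m + v m)) atTop (𝓝 0) := by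
    refine tendsto_zero_of_natCast_add_mul_bounded (j := 2)
      (C := 2 * (1 + ((1 + C) / (1 - α) + C)) + (1 + C) / (1 - α)) two_pos fun m => ?_
    have e : ((m : ℝ) + 2) * (u m - 1 - α * (u m + v m)) =
        -((2 - a) * (1 + α * (u m + v m)) + α * u m) := by linarith [h m]
    have hm := hu m
    have hm' := hv m
    have h2 : 0 ≤ 2 - a := by linarith
    rw [e, abs_neg, abs_of_nonneg (by positivity)]
    have hub := clique_le h0 h1 ha2 (hu m) (hv m) (hvC m) (h m)
    have hs : α * (u m + v m) ≤ (1 + C) / (1 - α) + C := by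
      have := hvC m
      nlinarith
    have hp : (2 - a) * (1 + α * (u m + v m)) ≤ 2 * (1 + ((1 + C) / (1 - α) + C)) := by
      gcongr
      linarith
    nlinarith
  have e1 : u = fun m => (1 + α * v m + (u m - 1 - α * (u m + v m))) / (1 - α) := by
    funext m
    rw [eq_div_iff hα]
    ring
  rw [e1]
  simpa using (((hv0.const_mul α).const_add 1).add he).div_const (1 - α)

theorem eventually_pageRank_node2_lt_node5 (α : ℝ) (h0 : 0 < α) (h1 : α < 1) :
    ∀ᶠ m : ℕ in atTop, pageRank α (graphG (m + 3)) (node2 (m + 3)) <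
      pageRank α (graphG (m + 3)) (node5 (m + 3)) := by
  choose c S hc hS hle e0 e1 e2 e3 e4 e5 e6 e8 hp2 hp5 using exists_potential_graphG α h0 h1
  obtain ⟨M, hM⟩ : ∃ M, M = 1 / (1 - α) := ⟨_, rfl⟩
  rw [← hM] at hle
  have hM0 : 0 < M := by rw [hM]; exact one_div_pos.mpr (by linarith)
  have b1 := fun m => hle m 1 (by decide) (by decide)
  have b2 := fun m => hle m 2 (by decide) (by decide)
  have b3 := fun m => hle m 3 (by decide) (by decide)
  have b4 := fun m => hle m 4 (by decide) (by decide)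
  have b6 := fun m => hle m 6 (by decide) (by decide)
  have b7 := fun m => hle m 7 (by decide) (by decide)
  have b0 := fun m => clique_le h0 h1 le_rfl (hS m 0) (hS m 1) (b1 m) (e0 m)
  have b8 := fun m => clique_le h0 h1 one_le_two (hS m 8)
    (add_nonneg (hS m 6) (hS m 7)) (add_le_add (b6 m) (b7 m))
    (by rw [e8 m]; ring)
  have t1 : Tendsto (fun m => S m 1) atTop (𝓝 0) := by
    refine tendsto_zero_of_natCast_add_mul_bounded (j := 4)
      (C := 1 + ((1 + M) / (1 - α) + M + M)) four_pos fun m => ?_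
    have := hS m 0; have := hS m 2; have := hS m 4
    rw [e1 m, abs_of_nonneg (by positivity)]
    nlinarith [b0 m, b2 m, b4 m]
  have t6 : Tendsto (fun m => S m 6) atTop (𝓝 0) := by
    refine tendsto_zero_of_natCast_add_mul_bounded (j := 3)
      (C := 1 + (M + M + (1 + (M + M)) / (1 - α))) three_pos fun m => ?_
    have := hS m 3; have := hS m 7; have := hS m 8
    rw [e6 m, abs_of_nonneg (by positivity)]
    nlinarith [b3 m, b7 m, b8 m]
  have d : 0 < 4 - α ^ 2 := by nlinarith
  have d' : 0 < 2 - α ^ 2 := by nlinarith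
  have t2 : Tendsto (fun m => 2 * S m 2) atTop (𝓝 (2 * (2 + α) / (4 - α ^ 2))) := by
    -- Eliminate `S m 3`, leaving only the boundary values `S m 1` and `S m 6`.
    have e : (fun m => 2 * S m 2) =
        fun m => 2 * (2 + α + 2 * α * S m 1 + α ^ 2 * S m 6) / (4 - α ^ 2) := by
      funext m
      rw [eq_div_iff d.ne']
      linear_combination 4 * e2 m + 2 * α * e3 m
    rw [e]
    simpa using ((((t1.const_mul (2 * α)).const_add (2 + α)).add
      (t6.const_mul (α ^ 2))).const_mul 2).div_const (4 - α ^ 2)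
  have t5 : Tendsto (fun m => S m 5) atTop (𝓝 ((2 + α) / (2 - α ^ 2))) := by
    have e : (fun m => S m 5) = fun m => (2 + α + α ^ 2 * S m 1) / (2 - α ^ 2) := by
      funext m
      rw [eq_div_iff d'.ne']
      linear_combination 2 * e5 m + α * e4 m
    rw [e]
    simpa using ((t1.const_mul (α ^ 2)).const_add (2 + α)).div_const (2 - α ^ 2)
  -- Cross-multiplied, this is `2 * (2 - α ^ 2) < 4 - α ^ 2`, that is, `0 < α ^ 2`.
  have hlt : 2 * (2 + α) / (4 - α ^ 2) < (2 + α) / (2 - α ^ 2) := by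
    rw [div_lt_div_iff₀ d d']
    have : 0 < (2 + α) * α ^ 2 := by positivity
    linarith
  filter_upwards [t2.eventually_lt t5 hlt] with m hm
  rw [hp2, hp5]
  exact mul_lt_mul_of_pos_left hm (hc m)

theorem eventually_pageRank_addEdge_node5_lt_node2 (α : ℝ) (h0 : 0 < α) (h1 : α < 1) :
    ∀ᶠ m : ℕ in atTop,
      pageRank α (addEdge (graphG (m + 3)) (node5 (m + 3)) (node7 (m + 3))) (node5 (m + 3)) <
        pageRank α (addEdge (graphG (m + 3)) (node5 (m + 3)) (node7 (m + 3))) (node2 (m + 3)) := by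
  choose c S hc hS hle e0 e1 e2 e3 e4 e5 e6 e7 e8 hp2 hp5 using exists_potential_addEdge α h0 h1
  obtain ⟨M, hM⟩ : ∃ M, M = 1 / (1 - α) := ⟨_, rfl⟩
  rw [← hM] at hle
  have hM0 : 0 < M := by rw [hM]; exact one_div_pos.mpr (by linarith)
  have b1 := fun m => hle m 1 (by decide) (by decide)
  have b2 := fun m => hle m 2 (by decide) (by decide)
  have b3 := fun m => hle m 3 (by decide) (by decide)
  have b4 := fun m => hle m 4 (by decide) (by decide)
  have b5 := fun m => hle m 5 (by decide) (by decide)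
  have b6 := fun m => hle m 6 (by decide) (by decide)
  have b7 := fun m => hle m 7 (by decide) (by decide)
  have b0 := fun m => clique_le h0 h1 le_rfl (hS m 0) (hS m 1) (b1 m) (e0 m)
  have e8' : ∀ m : ℕ, (m + 2) * S m 8 =
      (m + 1) + α * ((m + 1) * (S m 8 + (S m 6 + S m 7)) - S m 8) := fun m => by
    rw [e8 m]; ring
  have b8 := fun m => clique_le h0 h1 one_le_two (hS m 8)
    (add_nonneg (hS m 6) (hS m 7)) (add_le_add (b6 m) (b7 m)) (e8' m)
  have t1 : Tendsto (fun m => S m 1) atTop (𝓝 0) := by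
    refine tendsto_zero_of_natCast_add_mul_bounded (j := 4)
      (C := 1 + ((1 + M) / (1 - α) + M + M)) four_pos fun m => ?_
    have := hS m 0; have := hS m 2; have := hS m 4
    rw [e1 m, abs_of_nonneg (by positivity)]
    nlinarith [b0 m, b2 m, b4 m]
  have t6 : Tendsto (fun m => S m 6) atTop (𝓝 0) := by
    refine tendsto_zero_of_natCast_add_mul_bounded (j := 3)
      (C := 1 + (M + M + (1 + (M + M)) / (1 - α))) three_pos fun m => ?_
    have := hS m 3; have := hS m 7; have := hS m 8
    rw [e6 m, abs_of_nonneg (by positivity)]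
    nlinarith [b3 m, b7 m, b8 m]
  have t7 : Tendsto (fun m => S m 7) atTop (𝓝 0) := by
    refine tendsto_zero_of_natCast_add_mul_bounded (j := 3)
      (C := 1 + (M + M + (1 + (M + M)) / (1 - α))) three_pos fun m => ?_
    have := hS m 5; have := hS m 6; have := hS m 8
    rw [e7 m, abs_of_nonneg (by positivity)]
    nlinarith [b5 m, b6 m, b8 m]
  have t0 : Tendsto (fun m => S m 0) atTop (𝓝 (1 / (1 - α))) :=
    tendsto_clique h0 h1 zero_le_two le_rfl (fun m => hS m 0) (fun m => hS m 1) b1 e0 t1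
  have t8 : Tendsto (fun m => S m 8) atTop (𝓝 (1 / (1 - α))) :=
    tendsto_clique h0 h1 zero_le_one one_le_two (fun m => hS m 8)
      (fun m => add_nonneg (hS m 6) (hS m 7)) (fun m => add_le_add (b6 m) (b7 m)) e8'
      (by simpa using t6.add t7)
  have d : 0 < 4 - α ^ 2 := by nlinarith
  -- Common form of all four gadget vertices: `x` is the adjacent anchor, `y` the one at the far end
  -- of the path.
  have hlim : ∀ {u x y : ℕ → ℝ}, Tendsto x atTop (𝓝 0) → Tendsto y atTop (𝓝 0) →
      (∀ m, u m = (2 + α + 2 * α * x m + α ^ 2 * y m) / (4 - α ^ 2)) →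
      Tendsto u atTop (𝓝 (1 / (2 - α))) := by
    intro u x y hx hy hu
    have e : (1 / (2 - α)) = (2 + α) / (4 - α ^ 2) := by
      rw [div_eq_div_iff (by linarith) d.ne']
      ring
    rw [e, funext hu]
    simpa using (((hx.const_mul (2 * α)).const_add (2 + α)).add
      (hy.const_mul (α ^ 2))).div_const (4 - α ^ 2)
  have t2 : Tendsto (fun m => S m 2) atTop (𝓝 (1 / (2 - α))) := hlim t1 t6 fun m => by
    rw [eq_div_iff d.ne']
    linear_combination 2 * e2 m + α * e3 m
  have t3 : Tendsto (fun m => S m 3) atTop (𝓝 (1 / (2 - α))) := hlim t6 t1 fun m => by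
    rw [eq_div_iff d.ne']
    linear_combination 2 * e3 m + α * e2 m
  have t4 : Tendsto (fun m => S m 4) atTop (𝓝 (1 / (2 - α))) := hlim t1 t7 fun m => by
    rw [eq_div_iff d.ne']
    linear_combination 2 * e4 m + α * e5 m
  have t5 : Tendsto (fun m => S m 5) atTop (𝓝 (1 / (2 - α))) := hlim t7 t1 fun m => by
    rw [eq_div_iff d.ne']
    linear_combination 2 * e5 m + α * e4 m
  -- The bracket of `key` below, whose limit decides the sign of `S m 2 - S m 5`.
  have t := ((((t0.add t2).add t4).const_mul (α * (2 - α))).sub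
    ((((t5.add t6).add t8).const_mul α).add t7 |>.const_mul 2)).add
    ((((t3.add t7).add t8).const_mul α).add t6 |>.const_mul α)
  have hpos : 0 < α * (2 - α) * (1 / (1 - α) + 1 / (2 - α) + 1 / (2 - α)) -
      2 * (α * (1 / (2 - α) + 0 + 1 / (1 - α)) + 0) +
      α * (α * (1 / (2 - α) + 0 + 1 / (1 - α)) + 0) := by
    -- The clique terms `1 / (1 - α)` cancel; what survives is `α * (2 - α) / (2 - α)`, from the
    -- extra gadget neighbour of vertex `1`.
    have e : (2 - α) * (1 / (2 - α)) = 1 := mul_one_div_cancel (by linarith)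
    have : α * (2 - α) * (1 / (1 - α) + 1 / (2 - α) + 1 / (2 - α)) -
      2 * (α * (1 / (2 - α) + 0 + 1 / (1 - α)) + 0) +
      α * (α * (1 / (2 - α) + 0 + 1 / (1 - α)) + 0) = α := by
      linear_combination α * e
    rw [this]
    exact h0
  filter_upwards [t.eventually_const_lt hpos] with m hm
  rw [hp2, hp5]
  refine mul_lt_mul_of_pos_left ?_ (hc m)
  -- Scaling by the degree `m + 4` of vertex `1` exposes the `1/m` term. The stray `S m 7` and `S m
  -- 6` arise because `7` and `6` have degree `m + 3`.
  have key : ((m : ℝ) + 4) * (4 - α ^ 2) * (S m 2 - S m 5) =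
      α * (α * (2 - α) * (S m 0 + S m 2 + S m 4) -
        2 * (α * (S m 5 + S m 6 + S m 8) + S m 7) +
        α * (α * (S m 3 + S m 7 + S m 8) + S m 6)) := by
    linear_combination (m + 4) * (2 * e2 m + α * e3 m - 2 * e5 m - α * e4 m) +
      α * (2 - α) * e1 m - 2 * α * e7 m + α ^ 2 * e6 m
  have hK : 0 < ((m : ℝ) + 4) * (4 - α ^ 2) := by positivity
  have h3 : 0 < ((m : ℝ) + 4) * (4 - α ^ 2) * (S m 2 - S m 5) := by
    rw [key]
    exact mul_pos h0 hm
  have := pos_of_mul_pos_right h3 hK.le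
  linarith

end Asymptotics

/-! ### From the score reversal to the failure of rank monotonicity. -/

theorem not_isRankMonotoneOn_graphG {c : (k : ℕ) → SimpleGraph (Vertex k) → Vertex k → ℝ} {k : ℕ}
    (h : ¬ (graphG k).Adj (node5 k) (node7 k))
    (hlt : c k (graphG k) (node2 k) < c k (graphG k) (node5 k))
    (hlt' : c k (addEdge (graphG k) (node5 k) (node7 k)) (node5 k) <
      c k (addEdge (graphG k) (node5 k) (node7 k)) (node2 k)) :
    ¬ IsRankMonotoneOn (c k) (graphG k) := fun hm =>
  have ne : ∀ {x y : Vertex k}, x.1 ≠ y.1 → x ≠ y := fun hxy e => hxy (congrArg Sigma.fst e)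
  not_le.mpr hlt' ((hm (node5 k) (node7 k) (ne (by decide : (5 : Fin 9) ≠ 7)) h (node2 k)
    (ne (by decide : (2 : Fin 9) ≠ 5)) (ne (by decide : (2 : Fin 9) ≠ 7))).1 hlt.le)

theorem not_adj_node5_node7 (k : ℕ) : ¬ (graphG k).Adj (node5 k) (node7 k) := by
  simp only [graphG, SimpleGraph.fromRel_adj, node5, node7, linkedLabels]
  exact fun h => absurd h.2 (by decide)

end SpectralRank

theorem mainTheorem1 (α : ℝ) (hα0 : 0 < α) (hα1 : α < 1) :
    (∃ (V : Type) (_ : Fintype V) (G : SimpleGraph V),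
      ¬ SpectralRank.IsRankMonotoneOn (SpectralRank.pageRank α) G) ∧
    (∃ K : ℕ, ∀ k : ℕ, K ≤ k →
      ¬ (SpectralRank.graphG k).Adj (SpectralRank.node5 k) (SpectralRank.node7 k) ∧
      SpectralRank.pageRank α (SpectralRank.graphG k) (SpectralRank.node2 k) <
        SpectralRank.pageRank α (SpectralRank.graphG k) (SpectralRank.node5 k) ∧
      SpectralRank.pageRank α
          (SpectralRank.addEdge (SpectralRank.graphG k) (SpectralRank.node5 k)
            (SpectralRank.node7 k)) (SpectralRank.node5 k) <
        SpectralRank.pageRank α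
          (SpectralRank.addEdge (SpectralRank.graphG k) (SpectralRank.node5 k)
            (SpectralRank.node7 k)) (SpectralRank.node2 k)) := by
  have hex : ∃ K : ℕ, ∀ k : ℕ, K ≤ k →
      ¬ (SpectralRank.graphG k).Adj (SpectralRank.node5 k) (SpectralRank.node7 k) ∧
      SpectralRank.pageRank α (SpectralRank.graphG k) (SpectralRank.node2 k) <
        SpectralRank.pageRank α (SpectralRank.graphG k) (SpectralRank.node5 k) ∧
      SpectralRank.pageRank α
          (SpectralRank.addEdge (SpectralRank.graphG k) (SpectralRank.node5 k)
            (SpectralRank.node7 k)) (SpectralRank.node5 k) <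
        SpectralRank.pageRank α
          (SpectralRank.addEdge (SpectralRank.graphG k) (SpectralRank.node5 k)
            (SpectralRank.node7 k)) (SpectralRank.node2 k) := by
    obtain ⟨N, hN⟩ := Filter.eventually_atTop.mp
      ((SpectralRank.eventually_pageRank_node2_lt_node5 α hα0 hα1).and
        (SpectralRank.eventually_pageRank_addEdge_node5_lt_node2 α hα0 hα1))
    refine ⟨N + 3, fun k hk => ?_⟩
    obtain ⟨m, rfl⟩ := Nat.exists_eq_add_of_le' (show 3 ≤ k by omega)
    exact ⟨SpectralRank.not_adj_node5_node7 _, hN m (by omega)⟩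
  refine ⟨?_, hex⟩
  obtain ⟨K, hK⟩ := hex
  obtain ⟨h, hlt, hlt'⟩ := hK K le_rfl
  exact ⟨SpectralRank.Vertex K, inferInstance, SpectralRank.graphG K,
    SpectralRank.not_isRankMonotoneOn_graphG
      (c := fun _ => SpectralRank.pageRank α) h hlt hlt'⟩
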